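/- All graphs are finite and simple, and logarithms are to base two. A clique cover of a graph $G$ is a collection of cliques of $G$ such that every edge $uv$ of $G$ satisfies $u,v\in X$ for some member $X$ of the collection; its size is the number of cliques in it. The sizes of a largest stable set and of a largest clique of $G$ are denoted by $\alpha(G)$ and $\omega(G)$. (a) For every integer $s\ge 3$ there exist $c>0$ and $C>0$ such that, for infinitely many $n$, there is a graph $G$ with $n$ vertices and with no stable set of size $s$ such that every clique cover of $G$ has size at least $$\frac{c\,n^{2-\frac{4}{s+1}}}{(\log n)^2}.$$ Moreover, $G$ can be chosen as the complete join of two copies of a graph $J$ (that is, two vertex-disjoint copies of $J$ together with all edges between them), where $J$ has $m=n/2$ vertices, $\alpha(J)<s$ and $\omega(J)<C\,m^{\frac{2}{s+1}}\log m$. (b) In particular, there exists $c>0$ such that, for infinitely many $n$, there is a graph $G$ with $n$ vertices and $\alpha(G)\le 3$ such that every clique cover of $G$ has size at least $c\,n^{6/5}/(\log n)^2$. (c) Consequently, graphs $G$ with $\alpha(G)\le 3$ do not all admit clique covers of size $O(|V(G)|)$: there is no constant $K$ such that, for all sufficiently large $n$, every $n$-vertex graph $G$ with $\alpha(G)\le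 3$ has a clique cover of size at most $Kn$. -/

import Mathlib

/-- A clique cover of `G`: a collection of cliques of `G` such that every edge `uv` of `G` has both
ends in some member of the collection. Its size is `𝒞.card`. -/
def IsCliqueCover {V : Type*} (G : SimpleGraph V) (𝒞 : Finset (Finset V)) : Prop :=
  (∀ X ∈ 𝒞, G.IsClique (X : Set V)) ∧ ∀ u v, G.Adj u v → ∃ X ∈ 𝒞, u ∈ X ∧ v ∈ X

/-- The complete join of two graphs: their disjoint union, together with all edges between the two
vertex sets. -/
def completeJoin {V W : Type*} (G : SimpleGraph V) (H : SimpleGraph W) : SimpleGraph (V ⊕ W) :=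
  G.sum H ⊔ completeBipartiteGraph V W

/-- `J` is a graph on `m` vertices with no stable set of size `s` and with
`ω(J) < C m ^ (2 / (s + 1)) log₂ m`. -/
def IsSpencerGraph (s : ℕ) (C : ℝ) {m : ℕ} (J : SimpleGraph (Fin m)) : Prop :=
  J.IndepSetFree s ∧
    (J.cliqueNum : ℝ) < C * (m : ℝ) ^ (2 / ((s : ℝ) + 1)) * Real.logb 2 m

/-! In the join of two copies of `J`, a clique meets each side in a clique of `J`, so it covers at
most `ω(J) ^ 2` of the `m ^ 2` cross edges; a stable set lies in one side. A `J` with no stable set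
of size `s` and with small cliques therefore forces large clique covers
(`IsCliqueCover.card_mul_card_le`).

Such `J` come from deletion in a random graph. Take random edges of density `p` of order `m ^ (-2 /
(s + 1))`, remove a maximal edge-disjoint family of copies of `K_s`, and let `J` be the complement
of the rest. Maximality leaves no `K_s`. If `S` is a `k`-clique of `J`, all random edges inside `S`
were deleted, so either `S` held few random edges or many edge-disjoint copies of `K_s` meet it in
an edge. Both are so unlikely that a union bound over `S` succeeds for `k` of order `m ^ (2 / (s +
1)) * log m`. -/

open Finset

/-! ### Probability estimates for random subsets, as finite weighted sums. -/

section RandomSubset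

variable {ι κ : Type*} [Fintype ι] [DecidableEq ι]

/-- The probability that the random subset of `ι`, containing each point independently with
probability `p`, equals `A`. -/
def bernoulliWeight (p : ℝ) (A : Finset ι) : ℝ := p ^ #A * (1 - p) ^ #Aᶜ

lemma bernoulliWeight_nonneg {p : ℝ} (hp₀ : 0 ≤ p) (hp₁ : p ≤ 1) (A : Finset ι) :
    0 ≤ bernoulliWeight p A :=
  mul_nonneg (pow_nonneg hp₀ _) (pow_nonneg (sub_nonneg.2 hp₁) _)

lemma sum_bernoulliWeight (p : ℝ) : ∑ A : Finset ι, bernoulliWeight p A = 1 := by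
  have h := prod_add (fun _ : ι => p) (fun _ => 1 - p) univ
  simp only [prod_const, powerset_univ, ← compl_eq_univ_sdiff, add_sub_cancel, one_pow] at h
  exact h.symm

lemma sum_bernoulliWeight_superset (p : ℝ) (B : Finset ι) :
    ∑ A : Finset ι with B ⊆ A, bernoulliWeight p A = p ^ #B := by
  have h := prod_add (fun _ : ι => p) (fun i => if i ∈ B then 0 else 1 - p) univ
  simp only [prod_const, powerset_univ, ← compl_eq_univ_sdiff] at h
  have h1 : ∏ i : ι, (p + if i ∈ B then 0 else 1 - p) = p ^ #B := by
    have : ∀ i : ι, (p + if i ∈ B then 0 else 1 - p) = if i ∈ B then p else 1 := by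
      intro i; split_ifs <;> ring
    simp only [this, prod_ite_mem, univ_inter, prod_const]
  rw [← h1, h, sum_filter]
  refine sum_congr rfl fun A _ => ?_
  split_ifs with hBA
  · rw [bernoulliWeight, ← prod_const (s := Aᶜ)]
    congr 1
    refine prod_congr rfl fun i hi => ?_
    rw [if_neg fun hB => mem_compl.1 hi (hBA hB)]
  · obtain ⟨i, hiB, hiA⟩ := not_subset.1 hBA
    have h0 : ∏ i ∈ Aᶜ, (if i ∈ B then 0 else 1 - p) = 0 :=
      prod_eq_zero (mem_compl.2 hiA) (by rw [if_pos hiB])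
    rw [h0, mul_zero]

/-- The expectation of `2 ^ (-#(A ∩ S))` factorises over points; each point of `S` contributes `p /
2 + (1 - p)`. -/
lemma sum_bernoulliWeight_mul_half_pow (p : ℝ) (S : Finset ι) :
    ∑ A : Finset ι, bernoulliWeight p A * (1 / 2) ^ #(A ∩ S) = (1 - p / 2) ^ #S := by
  have h := prod_add (fun i : ι => p * if i ∈ S then 1 / 2 else 1) (fun _ => 1 - p) univ
  simp only [prod_const, powerset_univ, ← compl_eq_univ_sdiff, prod_mul_distrib, prod_ite_mem] at h
  have h1 : ∏ i : ι, ((p * if i ∈ S then 1 / 2 else 1) + (1 - p)) = (1 - p / 2) ^ #S := by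
    have : ∀ i : ι, ((p * if i ∈ S then 1 / 2 else 1) + (1 - p)) =
        if i ∈ S then 1 - p / 2 else 1 := by
      intro i; split_ifs <;> ring
    simp only [this, prod_ite_mem, univ_inter, prod_const]
  rw [← h1, h]
  refine sum_congr rfl fun A _ => ?_
  rw [bernoulliWeight]
  ring

/-- Markov's inequality for `2 ^ (-#(A ∩ S))`: a Chernoff-type lower tail. -/
lemma sum_bernoulliWeight_card_inter_lt_le {p : ℝ} (hp₀ : 0 ≤ p) (hp₁ : p ≤ 1) (S : Finset ι)
    (q : ℕ) :
    ∑ A : Finset ι with #(A ∩ S) < q, bernoulliWeight p A ≤ 2 ^ q * (1 - p / 2) ^ #S := by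
  rw [← sum_bernoulliWeight_mul_half_pow, mul_sum, sum_filter]
  refine sum_le_sum fun A _ => ?_
  have hw := bernoulliWeight_nonneg hp₀ hp₁ A
  split_ifs with hA
  · have h1 : (1 : ℝ) ≤ 2 ^ q * (1 / 2) ^ #(A ∩ S) := by
      rw [one_div, inv_pow, ← div_eq_mul_inv, one_le_div (by positivity)]
      exact pow_le_pow_right₀ (by norm_num) hA.le
    calc bernoulliWeight p A ≤ bernoulliWeight p A * (2 ^ q * (1 / 2) ^ #(A ∩ S)) :=
          le_mul_of_one_le_right hw h1
      _ = _ := by ring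
  · positivity

lemma sum_bernoulliWeight_exists_le {p : ℝ} (hp₀ : 0 ≤ p) (hp₁ : p ≤ 1) (I : Finset κ)
    (P : κ → Finset ι → Prop) [∀ i, DecidablePred (P i)]
    [DecidablePred fun A => ∃ i ∈ I, P i A] :
    ∑ A : Finset ι with ∃ i ∈ I, P i A, bernoulliWeight p A ≤
      ∑ i ∈ I, ∑ A : Finset ι with P i A, bernoulliWeight p A := by
  simp only [sum_filter]
  rw [sum_comm]
  refine sum_le_sum fun A _ => ?_
  have hw := bernoulliWeight_nonneg hp₀ hp₁ A
  have h0 : ∀ i ∈ I, 0 ≤ if P i A then bernoulliWeight p A else 0 := by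
    intro i _; split_ifs <;> simp [hw]
  split_ifs with h
  · obtain ⟨i, hi, hP⟩ := h
    calc bernoulliWeight p A = if P i A then bernoulliWeight p A else 0 := by rw [if_pos hP]
      _ ≤ _ := single_le_sum (f := fun i => if P i A then bernoulliWeight p A else 0) h0 hi
  · exact sum_nonneg h0

end RandomSubset

/-! ### Deleting a packing of complete subgraphs from a random graph. -/

section Pairs

variable {V : Type*} [DecidableEq V]

/-- The set of edges of the complete graph on the vertex set `T`. -/
def completeEdges (T : Finset V) : Finset (Sym2 V) := T.offDiag.image (Function.uncurry Sym2.mk)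

lemma card_completeEdges (T : Finset V) : #(completeEdges T) = (#T).choose 2 :=
  Sym2.card_image_offDiag T

lemma mk_mem_completeEdges {T : Finset V} {u v : V} :
    s(u, v) ∈ completeEdges T ↔ u ∈ T ∧ v ∈ T ∧ u ≠ v := by
  simp only [completeEdges, mem_image, mem_offDiag, Prod.exists, Function.uncurry_apply_pair,
    Sym2.eq_iff]
  grind

variable [Fintype V]

/-- The `s`-element sets of vertices that share an edge with the complete graph on `S`. -/
def setsSharingEdge (s : ℕ) (S : Finset V) : Finset (Finset V) :=
  {T ∈ powersetCard s univ | ¬ Disjoint (completeEdges T) (completeEdges S)}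

/-- Such a set is recovered from the two ends in `S` of a shared edge and its other `s - 2`
vertices. -/
lemma card_setsSharingEdge_le {s : ℕ} (S : Finset V) :
    #(setsSharingEdge s S) ≤ #S ^ 2 * Fintype.card V ^ (s - 2) := by
  have hsub : setsSharingEdge s S ⊆ (S ×ˢ S ×ˢ powersetCard (s - 2) univ).image
      (fun x => insert x.1 (insert x.2.1 x.2.2)) := by
    intro T hT
    obtain ⟨hTs, hTS⟩ := mem_filter.1 hT
    obtain ⟨e, heT, heS⟩ := not_disjoint_iff.1 hTS
    induction e with | _ u v
    obtain ⟨huT, hvT, huv⟩ := mk_mem_completeEdges.1 heT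
    obtain ⟨huS, hvS, -⟩ := mk_mem_completeEdges.1 heS
    have hv : v ∈ T.erase u := mem_erase.2 ⟨huv.symm, hvT⟩
    refine mem_image.2 ⟨(u, v, (T.erase u).erase v), ?_, ?_⟩
    · simp only [mem_product, mem_powersetCard_univ]
      refine ⟨huS, hvS, ?_⟩
      rw [card_erase_of_mem hv, card_erase_of_mem huT, mem_powersetCard_univ.1 hTs]
      omega
    · simp only [insert_erase hv, insert_erase huT]
  calc #(setsSharingEdge s S) ≤ #(S ×ˢ S ×ˢ powersetCard (s - 2) (univ : Finset V)) :=
        (card_le_card hsub).trans card_image_le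
    _ = #S ^ 2 * (Fintype.card V).choose (s - 2) := by
        rw [card_product, card_product, card_powersetCard, card_univ]; ring
    _ ≤ _ := Nat.mul_le_mul_left _ (Nat.choose_le_pow _ _)

/-- Deleting from the graph with edge set `A` a maximal family of edge-disjoint complete subgraphs
on `s` vertices leaves a graph without such subgraphs. It has no stable set of size `k` if `A` has
many edges on each set of size `k`, and few edge-disjoint complete subgraphs using them. -/
lemma exists_indepSetFree_cliqueFree_of_packing {s k t : ℕ} (hs : 2 ≤ s) (A : Finset (Sym2 V))
    (hedges : ∀ S ∈ powersetCard k univ, t * s.choose 2 ≤ #(A ∩ completeEdges S))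
    (hpack : ∀ S ∈ powersetCard k univ, ∀ F ∈ powersetCard t (setsSharingEdge s S),
      (F : Set (Finset V)).PairwiseDisjoint completeEdges → ¬ F.biUnion completeEdges ⊆ A) :
    ∃ J : SimpleGraph V, J.IndepSetFree s ∧ J.CliqueFree k := by
  classical
  have hD : 0 < s.choose 2 := Nat.choose_pos hs
  let packings : Finset (Finset (Finset V)) :=
    {F ∈ (powersetCard s (univ : Finset V)).powerset |
      (F : Set (Finset V)).PairwiseDisjoint completeEdges ∧ F.biUnion completeEdges ⊆ A}
  obtain ⟨F, hF, hmax⟩ := packings.exists_maximal ⟨∅, by simp [packings]⟩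
  simp only [packings, mem_filter, mem_powerset] at hF hmax
  obtain ⟨hFs, hFd, hFA⟩ := hF
  refine ⟨(SimpleGraph.fromEdgeSet (A \ F.biUnion completeEdges : Finset (Sym2 V)))ᶜ, ?_, ?_⟩
  · rintro T ⟨hT, hTs⟩
    have hTE : completeEdges T ⊆ A \ F.biUnion completeEdges := by
      intro e he
      induction e with | _ u v
      obtain ⟨hu, hv, huv⟩ := mk_mem_completeEdges.1 he
      have : ¬ SimpleGraph.Adj _ u v := hT hu hv huv
      rw [SimpleGraph.compl_adj, SimpleGraph.fromEdgeSet_adj] at this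
      by_contra hne
      exact this ⟨huv, fun h => hne (mem_coe.1 h.1)⟩
    have hTdisj : ∀ T' ∈ F, Disjoint (completeEdges T) (completeEdges T') := fun T' hT' =>
      disjoint_left.2 fun e he he' =>
        (mem_sdiff.1 (hTE he)).2 (mem_biUnion.2 ⟨T', hT', he'⟩)
    -- `T` could be added to the packing, so maximality puts it there already; then its nonempty
    -- edge set is disjoint from itself.
    have hTF : T ∈ F := by
      refine hmax (y := insert T F) ⟨?_, ?_, ?_⟩ (subset_insert T F) (mem_insert_self T F)
      · exact insert_subset (mem_powersetCard_univ.2 hTs) hFs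
      · rw [coe_insert]
        exact hFd.insert fun T' hT' _ => hTdisj T' hT'
      · rw [biUnion_insert]
        exact union_subset (hTE.trans sdiff_subset) hFA
    have h0 := card_completeEdges T
    rw [disjoint_self_iff_empty _ |>.1 (hTdisj T hTF), hTs, card_empty] at h0
    omega
  · rintro S ⟨hS, hSk⟩
    have hSk' : S ∈ powersetCard k (univ : Finset V) := mem_powersetCard_univ.2 hSk
    let FS := F.filter fun T => ¬ Disjoint (completeEdges T) (completeEdges S)
    have hcover : A ∩ completeEdges S ⊆ FS.biUnion completeEdges := by
      intro e he
      obtain ⟨heA, heS⟩ := mem_inter.1 he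
      have heF : e ∈ F.biUnion completeEdges := by
        induction e with | _ u v
        obtain ⟨hu, hv, huv⟩ := mk_mem_completeEdges.1 heS
        have := hS hu hv huv
        rw [SimpleGraph.compl_adj, SimpleGraph.fromEdgeSet_adj] at this
        by_contra hne
        exact this.2 ⟨mem_coe.2 (mem_sdiff.2 ⟨heA, hne⟩), huv⟩
      obtain ⟨T, hT, heT⟩ := mem_biUnion.1 heF
      exact mem_biUnion.2 ⟨T, mem_filter.2 ⟨hT, not_disjoint_iff.2 ⟨e, heT, heS⟩⟩, heT⟩
    -- Each member of `FS` covers at most `s.choose 2` of the edges of `A` inside `S`, so `FS` has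
    -- at least `t` members.
    have hcard : t * s.choose 2 ≤ #FS * s.choose 2 := by
      refine (hedges S hSk').trans ((card_le_card hcover).trans ?_)
      refine card_biUnion_le_card_mul _ _ _ fun T hT => ?_
      rw [card_completeEdges, mem_powersetCard_univ.1 (hFs (mem_filter.1 hT).1)]
    obtain ⟨F', hF', hF't⟩ := exists_subset_card_eq (Nat.le_of_mul_le_mul_right hcard hD)
    have hF'F : F' ⊆ F := hF'.trans (filter_subset _ _)
    refine hpack S hSk' F' (mem_powersetCard.2 ⟨fun T hT => ?_, hF't⟩)
      (hFd.subset (coe_subset.2 hF'F)) ((biUnion_subset_biUnion_of_subset_left _ hF'F).trans hFA)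
    exact mem_filter.2 ⟨hFs (hF'F hT), (mem_filter.1 (hF' hT)).2⟩

open Classical in
/-- The edge-disjoint families of `t` complete graphs on `s` vertices, each sharing an edge with
the complete graph on `S`. -/
noncomputable def edgeDisjointFamilies (s t : ℕ) (S : Finset V) : Finset (Finset (Finset V)) :=
  {F ∈ powersetCard t (setsSharingEdge s S) |
    (F : Set (Finset V)).PairwiseDisjoint completeEdges}

open Classical in
-- Edge-disjointness makes each union have exactly `t * s.choose 2` edges, so the union bound over
-- families costs only a binomial coefficient.
lemma sum_bernoulliWeight_edgeDisjointFamilies_le {p : ℝ} (hp₀ : 0 ≤ p) (hp₁ : p ≤ 1) (s t : ℕ)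
    (S : Finset V) :
    ∑ A with ∃ F ∈ edgeDisjointFamilies s t S, F.biUnion completeEdges ⊆ A, bernoulliWeight p A ≤
      (#S ^ 2 * Fintype.card V ^ (s - 2)).choose t * p ^ (t * s.choose 2) := by
  refine (sum_bernoulliWeight_exists_le hp₀ hp₁ (edgeDisjointFamilies s t S)
    fun F A => F.biUnion completeEdges ⊆ A).trans ?_
  calc ∑ F ∈ edgeDisjointFamilies s t S,
        ∑ A with F.biUnion completeEdges ⊆ A, bernoulliWeight p A
      = ∑ F ∈ edgeDisjointFamilies s t S, p ^ (t * s.choose 2) := by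
        refine sum_congr rfl fun F hF => ?_
        obtain ⟨hF, hFd⟩ := mem_filter.1 hF
        obtain ⟨hFs, hFt⟩ := mem_powersetCard.1 hF
        have hcard : #(F.biUnion completeEdges) = t * s.choose 2 := by
          rw [card_biUnion hFd, sum_const_nat (m := s.choose 2), hFt]
          intro T hT
          rw [card_completeEdges, mem_powersetCard_univ.1 (mem_filter.1 (hFs hT)).1]
        rw [← hcard]
        convert sum_bernoulliWeight_superset p (F.biUnion completeEdges)
    _ ≤ _ := by
        rw [sum_const, nsmul_eq_mul]
        refine mul_le_mul_of_nonneg_right (Nat.cast_le.2 ?_) (pow_nonneg hp₀ _)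
        refine (card_filter_le _ _).trans ?_
        rw [card_powersetCard]
        exact Nat.choose_le_choose _ (card_setsSharingEdge_le S)

lemma exists_indepSetFree_cliqueFree {s k t : ℕ} (hs : 2 ≤ s) {p : ℝ} (hp₀ : 0 ≤ p) (hp₁ : p ≤ 1)
    (h : (Fintype.card V : ℝ) ^ k * (2 ^ (t * s.choose 2) * (1 - p / 2) ^ k.choose 2 +
      (k ^ 2 * Fintype.card V ^ (s - 2)).choose t * p ^ (t * s.choose 2)) < 1) :
    ∃ J : SimpleGraph V, J.IndepSetFree s ∧ J.CliqueFree k := by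
  classical
  let bad : Finset V → Finset (Sym2 V) → Prop := fun S A =>
    #(A ∩ completeEdges S) < t * s.choose 2 ∨
      ∃ F ∈ edgeDisjointFamilies s t S, F.biUnion completeEdges ⊆ A
  have hbad : ∀ S ∈ powersetCard k (univ : Finset V),
      ∑ A with bad S A, bernoulliWeight p A ≤
        2 ^ (t * s.choose 2) * (1 - p / 2) ^ k.choose 2 +
          (k ^ 2 * Fintype.card V ^ (s - 2)).choose t * p ^ (t * s.choose 2) := by
    intro S hS
    have h1 := sum_bernoulliWeight_card_inter_lt_le hp₀ hp₁ (completeEdges S) (t * s.choose 2)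
    have h2 := sum_bernoulliWeight_edgeDisjointFamilies_le hp₀ hp₁ s t S
    rw [card_completeEdges, mem_powersetCard_univ.1 hS] at h1
    rw [mem_powersetCard_univ.1 hS] at h2
    refine le_trans ?_ (add_le_add h1 h2)
    simp only [bad]
    rw [filter_or, ← sum_union_inter]
    exact le_add_of_nonneg_right (sum_nonneg fun A _ => bernoulliWeight_nonneg hp₀ hp₁ A)
  obtain ⟨A, hA⟩ : ∃ A : Finset (Sym2 V),
      ¬ ∃ S ∈ powersetCard k (univ : Finset V), bad S A := by
    by_contra! hall
    refine absurd (sum_bernoulliWeight (ι := Sym2 V) p) (ne_of_lt (lt_of_le_of_lt ?_ h))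
    calc ∑ A : Finset (Sym2 V), bernoulliWeight p A
        = ∑ A with ∃ S ∈ powersetCard k (univ : Finset V), bad S A,
            bernoulliWeight p A := by
          rw [filter_true_of_mem fun A _ => hall A]
      _ ≤ ∑ S ∈ powersetCard k (univ : Finset V), ∑ A with bad S A, bernoulliWeight p A :=
          sum_bernoulliWeight_exists_le hp₀ hp₁ _ bad
      _ ≤ _ := sum_le_sum hbad
      _ ≤ _ := by
          rw [sum_const, nsmul_eq_mul, card_powersetCard, card_univ]
          refine mul_le_mul_of_nonneg_right (by exact_mod_cast Nat.choose_le_pow _ _) ?_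
          have : 0 ≤ 1 - p / 2 := by linarith
          positivity
  have hA' : ∀ S ∈ powersetCard k (univ : Finset V), ¬ bad S A := fun S hS h => hA ⟨S, hS, h⟩
  exact exists_indepSetFree_cliqueFree_of_packing (t := t) hs A
    (fun S hS => not_lt.1 fun hlt => hA' S hS (Or.inl hlt))
    fun S hS F hF hFd hFA => hA' S hS (Or.inr ⟨F, mem_filter.2 ⟨hF, hFd⟩, hFA⟩)

end Pairs

/-! ### Choice of parameters and the numerical union bound. -/

section Asymptotics

/-- Uses `Q.choose t ≤ (e * Q / t) ^ t`; since `9 ≥ e ^ 2`, each of the `t` factors is at most `1 /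
e`. -/
lemma choose_mul_pow_le_exp {Q t D : ℕ} (ht : 0 < t) {p : ℝ} (hp₀ : 0 ≤ p)
    (h : 9 * (Q * p ^ D) ≤ t) : (Q.choose t : ℝ) * p ^ (t * D) ≤ Real.exp (-t) := by
  have ht' : (0 : ℝ) < t := by exact_mod_cast ht
  have he : Real.exp 1 * Real.exp 1 ≤ 9 := by nlinarith [Real.exp_one_lt_three, Real.exp_pos 1]
  have hfac : (t : ℝ) ^ t / t.factorial ≤ Real.exp 1 ^ t := by
    rw [← Real.exp_nat_mul, mul_one]
    exact Real.pow_div_factorial_le_exp _ ht'.le _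
  have hstep : Real.exp 1 * (Q * p ^ D) / t ≤ Real.exp (-1) := by
    rw [Real.exp_neg, div_le_iff₀ ht', ← div_eq_inv_mul, le_div_iff₀ (Real.exp_pos 1)]
    calc Real.exp 1 * (Q * p ^ D) * Real.exp 1 = Real.exp 1 * Real.exp 1 * (Q * p ^ D) := by ring
      _ ≤ 9 * (Q * p ^ D) := by gcongr
      _ ≤ t := h
  calc (Q.choose t : ℝ) * p ^ (t * D) ≤ (Q : ℝ) ^ t / t.factorial * p ^ (t * D) := by
        gcongr; exact Nat.choose_le_pow_div _ _
    _ = (t : ℝ) ^ t / t.factorial * (Q * p ^ D / t) ^ t := by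
        rw [div_pow, mul_pow, ← pow_mul, mul_comm D t]; field_simp
    _ ≤ Real.exp 1 ^ t * (Q * p ^ D / t) ^ t := by gcongr
    _ = (Real.exp 1 * (Q * p ^ D) / t) ^ t := by rw [← mul_pow, ← mul_div_assoc (Real.exp 1)]
    _ ≤ Real.exp (-1) ^ t := by gcongr
    _ = Real.exp (-t) := by rw [← Real.exp_nat_mul]; ring_nf

lemma two_pow_mul_pow_le_exp {p : ℝ} (hp₁ : p ≤ 1) (q N : ℕ) :
    (2 : ℝ) ^ q * (1 - p / 2) ^ N ≤ Real.exp (q - p / 2 * N) := by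
  have h2 : (2 : ℝ) ≤ Real.exp 1 := by linarith [Real.add_one_le_exp 1]
  have h3 : 1 - p / 2 ≤ Real.exp (-(p / 2)) := by linarith [Real.add_one_le_exp (-(p / 2))]
  have h4 : 0 ≤ 1 - p / 2 := by linarith
  calc (2 : ℝ) ^ q * (1 - p / 2) ^ N ≤ Real.exp 1 ^ q * Real.exp (-(p / 2)) ^ N := by gcongr
    _ = _ := by rw [← Real.exp_nat_mul, ← Real.exp_nat_mul, ← Real.exp_add]; ring_nf

/-- Numerical form of the union bound; `p` is the edge density, and the hypothesis `hr`
says that a given edge is expected to lie in few complete subgraphs with `D` edges. -/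
lemma union_bound_lt_one {n k D r : ℕ} (hn : 1 < n) (hD : 0 < D) {p : ℝ} (hp₀ : 0 < p)
    (hp₁ : p ≤ 1) (hk : 2 ≤ k) (hpk : 32 * D * Real.log n ≤ p * k)
    (hr : 144 * D * ((n : ℝ) ^ r * p ^ D) ≤ p) (hnD : Real.exp D + 1 < n) :
    (n : ℝ) ^ k * (2 ^ (⌈p * k ^ 2 / (16 * D)⌉₊ * D) * (1 - p / 2) ^ k.choose 2 +
      (k ^ 2 * n ^ r).choose ⌈p * k ^ 2 / (16 * D)⌉₊ *
        p ^ (⌈p * k ^ 2 / (16 * D)⌉₊ * D)) < 1 := by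
  have hn0 : (0 : ℝ) < n := by exact_mod_cast (by omega : 0 < n)
  have hD' : (1 : ℝ) ≤ D := by exact_mod_cast hD
  have hk' : (2 : ℝ) ≤ k := by exact_mod_cast hk
  have hL : 0 < Real.log n := Real.log_pos (by exact_mod_cast hn)
  have hy : 0 < p * k ^ 2 / (16 * D) := by positivity
  have ht0 : 0 < ⌈p * k ^ 2 / (16 * D)⌉₊ := Nat.ceil_pos.2 hy
  have hty := Nat.le_ceil (p * k ^ 2 / (16 * D))
  have hty' := Nat.ceil_lt_add_one hy.le
  -- Both failure probabilities will be of order `n ^ (-2 * k)`, which beats the at most `n ^ k`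
  -- choices of `S`.
  have hyk : 2 * (k * Real.log n) ≤ p * k ^ 2 / (16 * D) := by
    rw [le_div_iff₀ (by positivity)]
    nlinarith
  have hyD : p * k ^ 2 / (16 * D) * D = p * k ^ 2 / 16 := by field_simp
  generalize ⌈p * k ^ 2 / (16 * D)⌉₊ = t at *
  have h1 : (2 : ℝ) ^ (t * D) * (1 - p / 2) ^ k.choose 2 ≤
      Real.exp (D - 2 * (k * Real.log n)) := by
    refine (two_pow_mul_pow_le_exp hp₁ _ _).trans (Real.exp_le_exp.2 ?_)
    have hch : (k : ℝ) ^ 2 / 4 ≤ (k.choose 2 : ℕ) := by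
      rw [Nat.cast_choose_two]; nlinarith
    -- The extra `D` is the cost of the ceiling; the main term is half of the `p * k ^ 2 / 8` gained
    -- from `hch`.
    have htD : (t : ℝ) * D ≤ p * k ^ 2 / 16 + D := by
      rw [← hyD]; nlinarith
    have hyk' : 2 * (k * Real.log n) ≤ p * k ^ 2 / 16 := by
      rw [← hyD]; exact hyk.trans (le_mul_of_one_le_right hy.le hD')
    have := mul_le_mul_of_nonneg_left hch (half_pos hp₀).le
    push_cast
    linarith
  have h2 : ((k ^ 2 * n ^ r).choose t : ℝ) * p ^ (t * D) ≤
      Real.exp (-(2 * (k * Real.log n))) := by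
    refine (choose_mul_pow_le_exp ht0 hp₀.le ?_).trans (Real.exp_le_exp.2 (by linarith))
    refine le_trans ?_ hty
    rw [le_div_iff₀ (by positivity)]
    push_cast
    calc 9 * ((k : ℝ) ^ 2 * n ^ r * p ^ D) * (16 * D)
        = 144 * D * ((n : ℝ) ^ r * p ^ D) * k ^ 2 := by ring
      _ ≤ p * k ^ 2 := by gcongr
  have hnk : (n : ℝ) ^ k = Real.exp (k * Real.log n) := by
    rw [Real.exp_nat_mul, Real.exp_log hn0]
  calc _ ≤ Real.exp (k * Real.log n) * (Real.exp (D - 2 * (k * Real.log n)) +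
        Real.exp (-(2 * (k * Real.log n)))) := by rw [hnk]; gcongr
    _ = Real.exp (-(k * Real.log n)) * (Real.exp D + 1) := by
        rw [mul_add, mul_add, ← Real.exp_add, ← Real.exp_add, ← Real.exp_add]; ring_nf
    _ ≤ Real.exp (-Real.log n) * (Real.exp D + 1) := by
        gcongr
        nlinarith
    _ < 1 := by
        rw [Real.exp_neg, Real.exp_log hn0, ← div_eq_inv_mul, div_lt_one hn0]
        exact hnD

lemma exists_eventually_isSpencerGraph {s : ℕ} (hs : 3 ≤ s) :
    ∃ C : ℝ, 0 < C ∧ ∀ᶠ m : ℕ in Filter.atTop, ∃ J : SimpleGraph (Fin m),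
      IsSpencerGraph s C J := by
  obtain ⟨D, hDs⟩ : ∃ D, D = s.choose 2 := ⟨_, rfl⟩
  have hs' : (3 : ℝ) ≤ s := by exact_mod_cast hs
  have hDr : (D : ℝ) = s * (s - 1) / 2 := by rw [hDs, Nat.cast_choose_two]
  have hD3 : (3 : ℝ) ≤ D := by rw [hDr]; nlinarith
  have hD1 : 2 ≤ D := by
    have : (2 : ℝ) ≤ D := by linarith
    exact_mod_cast this
  refine ⟨4608 * D ^ 2 * Real.log 2, by positivity, ?_⟩
  have hlarge : ∀ᶠ m : ℕ in Filter.atTop, Real.exp D + 1 < m :=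
    tendsto_natCast_atTop_atTop.eventually_gt_atTop _
  filter_upwards [hlarge] with n hn
  have hexp : (4 : ℝ) ≤ Real.exp D := by linarith [Real.add_one_le_exp (D : ℝ)]
  have hn1 : (1 : ℝ) < n := by linarith
  have hn0 : (0 : ℝ) < n := by linarith
  have hL : 1 ≤ Real.log n := by
    rw [Real.le_log_iff_exp_le hn0]
    refine (Real.exp_le_exp.2 (by linarith : (1 : ℝ) ≤ D)).trans (by linarith)
  set θ : ℝ := 2 / ((s : ℝ) + 1) with hθ
  have hθ0 : 0 < θ := by positivity
  have hnθ : 1 ≤ (n : ℝ) ^ θ := Real.one_le_rpow hn1.le hθ0.le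
  set ε : ℝ := 1 / (144 * D) with hε
  have hε0 : 0 < ε := by positivity
  have hε1 : ε ≤ 1 := by rw [hε, div_le_one (by positivity)]; linarith
  set p : ℝ := ε / (n : ℝ) ^ θ with hp
  have hp0 : 0 < p := by positivity
  have hp1 : p ≤ 1 := by rw [hp, div_le_one (by positivity)]; linarith
  -- Chosen so that `p * x = 32 * D * log n`; `4608 = 32 * 144`.
  set x : ℝ := 4608 * D ^ 2 * ((n : ℝ) ^ θ * Real.log n) with hx
  have hx1 : 1 < x := by
    have h1 : 1 ≤ (n : ℝ) ^ θ * Real.log n := one_le_mul_of_one_le_of_one_le hnθ hL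
    nlinarith
  have hpx : p * x = 32 * D * Real.log n := by
    rw [hp, hx, hε]; field_simp; norm_num
  have hr : 144 * D * ((n : ℝ) ^ (s - 2) * p ^ D) ≤ p := by
    -- This identity dictates `θ`: `D - 1 = (s - 2) * (s + 1) / 2`, so `θ * (D - 1) = s - 2`.
    have hnp : (n : ℝ) ^ (s - 2) * p ^ (D - 1) = ε ^ (D - 1) := by
      have : (((n : ℝ) ^ θ)) ^ (D - 1) = (n : ℝ) ^ (s - 2) := by
        rw [← Real.rpow_natCast, ← Real.rpow_mul hn0.le, ← Real.rpow_natCast]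
        congr 1
        rw [Nat.cast_sub (by omega), Nat.cast_sub (by omega), hDr, hθ]
        push_cast
        field_simp
        ring
      rw [hp, div_pow, this]
      field_simp
    have hεD : ε ^ (D - 1) ≤ ε := pow_le_of_le_one hε0.le hε1 (by omega)
    calc 144 * D * ((n : ℝ) ^ (s - 2) * p ^ D)
        = 144 * D * ((n : ℝ) ^ (s - 2) * p ^ (D - 1)) * p := by
          rw [← Nat.sub_add_cancel (by omega : 1 ≤ D), pow_succ]
          simp only [Nat.add_sub_cancel]
          ring
      _ ≤ 144 * D * ε * p := by rw [hnp]; gcongr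
      _ = p := by rw [hε]; field_simp
  have hkey := union_bound_lt_one (n := n) (k := ⌈x⌉₊) (D := D) (r := s - 2) (p := p)
    (by exact_mod_cast hn1) (by omega) hp0 hp1 (Nat.lt_ceil.2 (by exact_mod_cast hx1))
    (by rw [← hpx]; gcongr; exact Nat.le_ceil x) hr hn
  obtain ⟨J, hJs, hJk⟩ := exists_indepSetFree_cliqueFree (V := Fin n) (s := s) (k := ⌈x⌉₊)
    (by omega) hp0.le hp1 (by rw [Fintype.card_fin, ← hDs]; exact hkey)
  refine ⟨J, hJs, ?_⟩
  have hlt : J.cliqueNum < ⌈x⌉₊ := by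
    by_contra! hle
    obtain ⟨T, hT⟩ := J.exists_isNClique_cliqueNum
    exact (hJk.mono hle) T hT
  refine (Nat.lt_ceil.1 hlt).trans_eq ?_
  have : Real.log 2 ≠ 0 := (Real.log_pos (by norm_num)).ne'
  rw [hx, Real.logb, ← hθ]
  field_simp

end Asymptotics

/-! ### Stable sets and clique covers of a complete join. -/

section Join

lemma completeJoin_adj_inl {V W : Type*} {G : SimpleGraph V} {H : SimpleGraph W} {u v : V} :
    (completeJoin G H).Adj (.inl u) (.inl v) ↔ G.Adj u v := by
  simp [completeJoin]

lemma completeJoin_adj_inr {V W : Type*} {G : SimpleGraph V} {H : SimpleGraph W} {u v : W} :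
    (completeJoin G H).Adj (.inr u) (.inr v) ↔ H.Adj u v := by
  simp [completeJoin]

lemma completeJoin_adj_inl_inr {V W : Type*} {G : SimpleGraph V} {H : SimpleGraph W} {u : V}
    {v : W} : (completeJoin G H).Adj (.inl u) (.inr v) := by
  simp [completeJoin]

lemma SimpleGraph.IndepSetFree.of_iso_completeJoin {U V W : Type*} {K : SimpleGraph U}
    {G : SimpleGraph V} {H : SimpleGraph W} {s : ℕ} (hG : G.IndepSetFree s)
    (hH : H.IndepSetFree s) (φ : K ≃g completeJoin G H) : K.IndepSetFree s := by
  classical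
  rintro T ⟨hT, hTs⟩
  have hT' : ∀ x ∈ T.map φ.toEquiv.toEmbedding, ∀ y ∈ T.map φ.toEquiv.toEmbedding,
      ¬ (completeJoin G H).Adj x y := by
    intro x hx y hy hxy
    obtain ⟨a, ha, rfl⟩ := mem_map.1 hx
    obtain ⟨b, hb, rfl⟩ := mem_map.1 hy
    have hab : K.Adj a b := φ.map_adj_iff.1 hxy
    exact hT ha hb hab.ne hab
  have hcard : #(T.map φ.toEquiv.toEmbedding) = s := by rw [card_map, hTs]
  generalize T.map φ.toEquiv.toEmbedding = R at hT' hcard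
  have hsum := card_toLeft_add_card_toRight (u := R)
  rcases R.toLeft.eq_empty_or_nonempty with hL | ⟨a, ha⟩
  · refine hH R.toRight ⟨fun x hx y hy _ hxy => ?_, by rw [← hcard, ← hsum, hL]; simp⟩
    exact hT' _ (mem_toRight.1 hx) _ (mem_toRight.1 hy) (completeJoin_adj_inr.2 hxy)
  · have hR : R.toRight = ∅ := eq_empty_of_forall_notMem fun b hb =>
      hT' _ (mem_toLeft.1 ha) _ (mem_toRight.1 hb) completeJoin_adj_inl_inr
    refine hG R.toLeft ⟨fun x hx y hy _ hxy => ?_, by rw [← hcard, ← hsum, hR]; simp⟩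
    exact hT' _ (mem_toLeft.1 hx) _ (mem_toLeft.1 hy) (completeJoin_adj_inl.2 hxy)

/-- Double counting of cross edges: those inside a clique form a product of a clique of `G` and a
clique of `H`. -/
lemma IsCliqueCover.card_mul_card_le {U V W : Type*} [Fintype V] [Fintype W] {K : SimpleGraph U}
    {G : SimpleGraph V} {H : SimpleGraph W} (φ : K ≃g completeJoin G H) {𝒞 : Finset (Finset U)}
    (h𝒞 : IsCliqueCover K 𝒞) :
    Fintype.card V * Fintype.card W ≤ #𝒞 * (G.cliqueNum * H.cliqueNum) := by
  classical
  let left : Finset U → Finset V := fun X => {v | φ.symm (.inl v) ∈ X}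
  let right : Finset U → Finset W := fun X => {w | φ.symm (.inr w) ∈ X}
  have hcover : (univ : Finset (V × W)) ⊆ 𝒞.biUnion fun X => left X ×ˢ right X := by
    rintro ⟨v, w⟩ -
    obtain ⟨X, hX, hv, hw⟩ := h𝒞.2 (φ.symm (.inl v)) (φ.symm (.inr w))
      (φ.symm.map_adj_iff.2 completeJoin_adj_inl_inr)
    exact mem_biUnion.2 ⟨X, hX, by simp [left, right, hv, hw]⟩
  rw [← Fintype.card_prod, ← card_univ]
  refine (card_le_card hcover).trans (card_biUnion_le_card_mul _ _ _ fun X hX => ?_)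
  rw [card_product]
  refine Nat.mul_le_mul (SimpleGraph.IsClique.card_le_cliqueNum (tc := ?_))
    (SimpleGraph.IsClique.card_le_cliqueNum (tc := ?_))
  · intro a ha b hb hab
    have := h𝒞.1 X hX (mem_filter.1 (mem_coe.1 ha)).2 (mem_filter.1 (mem_coe.1 hb)).2 (by simpa)
    exact completeJoin_adj_inl.1 (φ.symm.map_adj_iff.1 this)
  · intro a ha b hb hab
    have := h𝒞.1 X hX (mem_filter.1 (mem_coe.1 ha)).2 (mem_filter.1 (mem_coe.1 hb)).2 (by simpa)
    exact completeJoin_adj_inr.1 (φ.symm.map_adj_iff.1 this)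

lemma IsSpencerGraph.le_card_cliqueCover {s m : ℕ} {C : ℝ} (hC : 0 < C) (hm : 2 ≤ m)
    {J : SimpleGraph (Fin m)} (hJ : IsSpencerGraph s C J) {G : SimpleGraph (Fin (2 * m))}
    (φ : G ≃g completeJoin J J) {𝒞 : Finset (Finset (Fin (2 * m)))} (h𝒞 : IsCliqueCover G 𝒞) :
    1 / (4 * C ^ 2) * ((2 * m : ℕ) : ℝ) ^ (2 - 4 / ((s : ℝ) + 1)) /
      Real.logb 2 (2 * m : ℕ) ^ 2 ≤ (#𝒞 : ℝ) := by
  have hm' : (2 : ℝ) ≤ m := by exact_mod_cast hm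
  have hm0 : (0 : ℝ) < m := by linarith
  have hlog : 0 < Real.logb 2 m := Real.logb_pos (by norm_num) (by linarith)
  have hlog2 : Real.logb 2 m ≤ Real.logb 2 (2 * m : ℕ) := by
    push_cast
    exact Real.logb_le_logb_of_le (by norm_num) hm0 (by linarith)
  have hcard := h𝒞.card_mul_card_le φ
  simp only [Fintype.card_fin] at hcard
  have hcard' : (m : ℝ) * m ≤ #𝒞 * ((J.cliqueNum : ℝ) * J.cliqueNum) := by exact_mod_cast hcard
  have hω := hJ.2.le
  have hpow : ((m : ℝ) ^ (2 / ((s : ℝ) + 1))) ^ 2 * (m : ℝ) ^ (2 - 4 / ((s : ℝ) + 1)) =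
      (m : ℝ) ^ 2 := by
    rw [← Real.rpow_natCast, ← Real.rpow_mul hm0.le, ← Real.rpow_add hm0, ← Real.rpow_natCast]
    congr 1
    push_cast
    ring
  have h2 : ((2 * m : ℕ) : ℝ) ^ (2 - 4 / ((s : ℝ) + 1)) ≤
      4 * (m : ℝ) ^ (2 - 4 / ((s : ℝ) + 1)) := by
    push_cast
    rw [Real.mul_rpow (by norm_num) hm0.le]
    gcongr
    calc (2 : ℝ) ^ (2 - 4 / ((s : ℝ) + 1)) ≤ 2 ^ (2 : ℝ) :=
          Real.rpow_le_rpow_of_exponent_le (by norm_num) (sub_le_self _ (by positivity))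
      _ = 4 := by norm_num
  set a := (m : ℝ) ^ (2 / ((s : ℝ) + 1))
  set b := (m : ℝ) ^ (2 - 4 / ((s : ℝ) + 1))
  have ha : 0 < a := Real.rpow_pos_of_pos hm0 _
  have hb : 0 < b := Real.rpow_pos_of_pos hm0 _
  have hmain : b ≤ #𝒞 * (C ^ 2 * Real.logb 2 m ^ 2) := by
    refine le_of_mul_le_mul_left ?_ (pow_pos ha 2)
    calc a ^ 2 * b = m * m := by rw [hpow]; ring
      _ ≤ #𝒞 * ((J.cliqueNum : ℝ) * J.cliqueNum) := hcard'
      _ ≤ #𝒞 * ((C * a * Real.logb 2 m) * (C * a * Real.logb 2 m)) := by gcongr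
      _ = _ := by ring
  rw [div_le_iff₀ (pow_pos (hlog.trans_le hlog2) 2), one_div, inv_mul_le_iff₀ (by positivity)]
  calc _ ≤ 4 * b := h2
    _ ≤ 4 * (#𝒞 * (C ^ 2 * Real.logb 2 m ^ 2)) := by gcongr
    _ = 4 * C ^ 2 * (#𝒞 * Real.logb 2 m ^ 2) := by ring
    _ ≤ _ := by gcongr

end Join

/-! ### Passage to infinitely many orders, and comparison with linear growth. -/

lemma frequently_nat_of_eventually_two_mul {P : ℕ → Prop}
    (h : ∀ᶠ m in Filter.atTop, P (2 * m)) : ∃ᶠ n in Filter.atTop, P n :=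
  (Filter.tendsto_id.const_mul_atTop' (by norm_num : 0 < 2)).frequently h.frequently

lemma eventually_mul_lt_rpow_div_logb_sq {c : ℝ} (hc : 0 < c) (K : ℝ) :
    ∀ᶠ n : ℕ in Filter.atTop,
      K * (n : ℝ) < c * (n : ℝ) ^ (6 / 5 : ℝ) / Real.logb 2 n ^ 2 := by
  have hl2 : 0 < Real.log 2 := Real.log_pos (by norm_num)
  -- `|K| + 1` keeps the divisor positive for every sign of `K` and makes the final inequality
  -- strict.
  have ho := (isLittleO_log_rpow_rpow_atTop (s := 1 / 5) 2 (by norm_num)).def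
    (c := c * Real.log 2 ^ 2 / (|K| + 1)) (by positivity)
  filter_upwards [tendsto_natCast_atTop_atTop.eventually ho, Filter.eventually_gt_atTop 1]
    with n hn hn1
  have hn1' : (1 : ℝ) < n := by exact_mod_cast hn1
  have hn0 : (0 : ℝ) < n := by linarith
  have hL : 0 < Real.log n := Real.log_pos hn1'
  rw [Real.rpow_two, Real.norm_of_nonneg (by positivity), Real.norm_of_nonneg (by positivity),
    div_mul_eq_mul_div, le_div_iff₀ (by positivity)] at hn
  have hpow : (n : ℝ) ^ (6 / 5 : ℝ) = n * (n : ℝ) ^ (1 / 5 : ℝ) := by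
    rw [← Real.rpow_one_add' hn0.le (by norm_num)]
    norm_num
  rw [hpow, Real.logb, div_pow, lt_div_iff₀ (by positivity), ← mul_div_assoc,
    div_lt_iff₀ (by positivity)]
  calc K * n * Real.log n ^ 2 < (|K| + 1) * n * Real.log n ^ 2 := by
        gcongr; linarith [le_abs_self K]
    _ = n * (Real.log n ^ 2 * (|K| + 1)) := by ring
    _ ≤ n * (c * Real.log 2 ^ 2 * (n : ℝ) ^ (1 / 5 : ℝ)) := by gcongr
    _ = _ := by ring

lemma exists_frequently_join_cliqueCover_lower_bound (s : ℕ) (hs : 3 ≤ s) :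
    ∃ c : ℝ, 0 < c ∧ ∃ C : ℝ, 0 < C ∧
      ∃ᶠ n : ℕ in Filter.atTop, ∃ G : SimpleGraph (Fin n),
        G.IndepSetFree s ∧
        (∃ (m : ℕ) (J : SimpleGraph (Fin m)), n = 2 * m ∧ IsSpencerGraph s C J ∧
          Nonempty (G ≃g completeJoin J J)) ∧
        ∀ 𝒞 : Finset (Finset (Fin n)), IsCliqueCover G 𝒞 →
          c * (n : ℝ) ^ (2 - 4 / ((s : ℝ) + 1)) / Real.logb 2 n ^ 2 ≤ (𝒞.card : ℝ) := by
  obtain ⟨C, hC, hJ⟩ := exists_eventually_isSpencerGraph hs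
  refine ⟨1 / (4 * C ^ 2), by positivity, C, hC, frequently_nat_of_eventually_two_mul ?_⟩
  filter_upwards [hJ, Filter.eventually_ge_atTop 2] with m ⟨J, hJ⟩ hm
  let e : Fin (2 * m) ≃ Fin m ⊕ Fin m := (finCongr (two_mul m)).trans finSumFinEquiv.symm
  let φ : (completeJoin J J).comap e ≃g completeJoin J J := SimpleGraph.Iso.comap e _
  exact ⟨_, hJ.1.of_iso_completeJoin hJ.1 φ, ⟨m, J, rfl, hJ, ⟨φ⟩⟩,
    fun 𝒞 h𝒞 => hJ.le_card_cliqueCover hC hm φ h𝒞⟩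

lemma exists_frequently_indepNum_le_three_cliqueCover_lower_bound :
    ∃ c : ℝ, 0 < c ∧ ∃ᶠ n : ℕ in Filter.atTop, ∃ G : SimpleGraph (Fin n),
      G.indepNum ≤ 3 ∧
      ∀ 𝒞 : Finset (Finset (Fin n)), IsCliqueCover G 𝒞 →
        c * (n : ℝ) ^ (6 / 5 : ℝ) / Real.logb 2 n ^ 2 ≤ (𝒞.card : ℝ) := by
  obtain ⟨c, hc, C, -, h⟩ := exists_frequently_join_cliqueCover_lower_bound 4 (by norm_num)
  refine ⟨c, hc, h.mono ?_⟩
  rintro n ⟨G, hG, -, hcov⟩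
  refine ⟨G, ?_, fun 𝒞 h𝒞 => ?_⟩
  · by_contra! hlt
    obtain ⟨T, hT⟩ := G.exists_isNIndepSet_indepNum
    obtain ⟨T', hT', hcard⟩ := exists_subset_card_eq (hT.card_eq.symm ▸ hlt : 4 ≤ #T)
    exact hG T' ⟨hT.isIndepSet.mono (coe_subset.2 hT'), hcard⟩
  · have h4 : (2 - 4 / (((4 : ℕ) : ℝ) + 1)) = 6 / 5 := by norm_num
    have := hcov 𝒞 h𝒞
    rwa [h4] at this

theorem theorem3p2 :
    -- the lower bound for every `s ≥ 3`, with the structure of the graphs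
    (∀ s : ℕ, 3 ≤ s → ∃ c : ℝ, 0 < c ∧ ∃ C : ℝ, 0 < C ∧
      ∃ᶠ n : ℕ in Filter.atTop, ∃ G : SimpleGraph (Fin n),
        G.IndepSetFree s ∧
        (∃ (m : ℕ) (J : SimpleGraph (Fin m)), n = 2 * m ∧ IsSpencerGraph s C J ∧
          Nonempty (G ≃g completeJoin J J)) ∧
        ∀ 𝒞 : Finset (Finset (Fin n)), IsCliqueCover G 𝒞 →
          c * (n : ℝ) ^ (2 - 4 / ((s : ℝ) + 1)) / Real.logb 2 n ^ 2 ≤ (𝒞.card : ℝ)) ∧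
    -- the case of stability number at most three
    (∃ c : ℝ, 0 < c ∧ ∃ᶠ n : ℕ in Filter.atTop, ∃ G : SimpleGraph (Fin n),
      G.indepNum ≤ 3 ∧
      ∀ 𝒞 : Finset (Finset (Fin n)), IsCliqueCover G 𝒞 →
        c * (n : ℝ) ^ (6 / 5 : ℝ) / Real.logb 2 n ^ 2 ≤ (𝒞.card : ℝ)) ∧
    -- graphs with stability number at most three need not have clique covers of linear size
    ¬ ∃ K : ℝ, ∀ᶠ n : ℕ in Filter.atTop, ∀ G : SimpleGraph (Fin n), G.indepNum ≤ 3 →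
      ∃ 𝒞 : Finset (Finset (Fin n)), IsCliqueCover G 𝒞 ∧ (𝒞.card : ℝ) ≤ K * (n : ℝ) := by
  refine ⟨exists_frequently_join_cliqueCover_lower_bound,
    exists_frequently_indepNum_le_three_cliqueCover_lower_bound, ?_⟩
  rintro ⟨K, hK⟩
  obtain ⟨c, hc, hfreq⟩ := exists_frequently_indepNum_le_three_cliqueCover_lower_bound
  obtain ⟨n, ⟨⟨G, hG, hcov⟩, hKn⟩, hlt⟩ :=
    ((hfreq.and_eventually hK).and_eventually (eventually_mul_lt_rpow_div_logb_sq hc K)).exists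
  obtain ⟨𝒞, h𝒞, hcard⟩ := hKn G hG
  linarith [hcov 𝒞 h𝒞]
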